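/- Let $d \le D$, let $\mathcal X, \mathcal Z \subset \mathbb R^D$ be finite, and put $\Theta_d = \{\theta \in \mathbb R^D : \theta_i = 0 \text{ for all } i > d\}$. For $x \in \mathbb R^D$ let $\psi_d(x) \in \mathbb R^d$ be the vector of the first $d$ coordinates of $x$. **Algorithms.** Let $\theta \in \Theta_d$ be an unknown reward vector. In round $t = 1, 2, \dots$ an algorithm plays an action $X_t \in \mathcal X$ that is measurable with respect to $\mathcal F_{t-1} = \sigma((X_i, Y_i)_{i < t})$, and observes $Y_t = \langle \theta, X_t\rangle + \xi_t$, where $\xi_1, \xi_2, \dots$ are i.i.d. $\mathcal N(0,1)$. It has a (possibly infinite) stopping time $\tau$ with respect to $(\mathcal F_t)_{t \ge 0}$ and an $\mathcal F_\tau$-measurable recommendation $\widehat z \in \mathcal Z$. Write $\mathbb P_\theta$, $\mathbb E_\theta$ for the resulting law and expectation. The algorithm is *$\delta$-PAC for $(\mathcal X, \mathcal Z, \Theta_d)$* if $$\mathbb P_\theta\Big(\tau < \infty \text{ and } \widehat z \in \operatorname*{argmax}_{z \in \mathcal Z} \langle \theta, z\rangle\Big) \ge 1 - \delta$$ for every $\theta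 \in \Theta_d$ whose optimal arm in $\mathcal Z$ is unique; here targets $z, z'$ with $\psi_d(z) = \psi_d(z')$, which have the same reward for every parameter in $\Theta_d$, count as the same arm. **Complexity.** Let $\theta_\star \in \Theta_d$ be such that $z_\star = \operatorname{argmax}_{z \in \mathcal Z} \langle \theta_\star, z \rangle$ is unique (as an element of $\mathcal Z$). For $\lambda$ in the probability simplex $\Lambda_{\mathcal X}$ over $\mathcal X$ put $A_d(\lambda) = \sum_{x \in \mathcal X} \lambda_x \psi_d(x)\psi_d(x)^\top$, and let $$\rho^\star_d = \inf_{\lambda \in \Lambda_{\mathcal X}} \ \sup_{z \in \mathcal Z \setminus \{z_\star\}} \frac{\|\psi_d(z_\star) - \psi_d(z)\|^2_{A_d(\lambda)^{-1}}}{\langle \theta_\star, z_\star - z\rangle^2} \in [0, \infty],$$ where $\|y\|^2_{A^{-1}} = y^\top A^{+} y$, with $A^+$ the pseudo-inverse, if $y$ lies in the range of $A$, and $\|y\|^2_{A^{-1}} = \infty$ otherwise (and the supremum over the empty set is $0$). **Theorem.** Let $\delta \in (0, 0.15]$. Every algorithm that is $\delta$-PAC for $(\mathcal X, \mathcal Z,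 \Theta_d)$ satisfies $$\mathbb E_{\theta_\star}[\tau] \ \ge\ \rho^\star_d \, \log\!\Big(\frac{1}{2.4\,\delta}\Big).$$ In particular this holds for $d = d_\star$, the smallest $d$ with $\theta_\star \in \Theta_d$. -/

import Mathlib

open MeasureTheory ProbabilityTheory
open scoped ENNReal Matrix

namespace LinearBandit

/-- The ambient feature space `ℝ^D`. -/
abbrev Vec (D : ℕ) : Type := EuclideanSpace ℝ (Fin D)

/-- The parameter class `Θ_d` of the vectors of `ℝ^D` whose coordinates after the first `d` vanish. -/
def paramClass (D d : ℕ) : Set (Vec D) := {θ | ∀ i : Fin D, d ≤ (i : ℕ) → θ i = 0}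

/-- The truncated feature vector `ψ_d(x)`, i.e. the first `d` coordinates of `x`. -/
def truncate {D d : ℕ} (hd : d ≤ D) (x : Vec D) : Fin d → ℝ := fun i => x (Fin.castLE hd i)

section Complexity

/-- The design matrix `A_d(l) = ∑_{x ∈ X} l_x ψ_d(x) ψ_d(x)ᵀ`. -/
noncomputable def designMatrix {D d : ℕ} (hd : d ≤ D) (X : Finset (Vec D)) (l : X → ℝ) :
    Matrix (Fin d) (Fin d) ℝ :=
  ∑ x : X, l x • Matrix.vecMulVec (truncate hd (x : Vec D)) (truncate hd (x : Vec D))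

open Classical in
/-- `‖y‖²_{A⁻¹}` for a symmetric, possibly singular matrix `A`: it is `yᵀ A⁺ y = yᵀ v`, for any `v`
with `A v = y`, if `y` is in the range of `A`, and `∞` otherwise. The lemmas below show that
the choice of `v` is immaterial, that every generalized inverse (in particular the pseudo-inverse)
gives the same value, and that this is `yᵀ A⁻¹ y` if `A` is invertible. -/
noncomputable def invNormSq {d : ℕ} (A : Matrix (Fin d) (Fin d) ℝ) (y : Fin d → ℝ) : ℝ≥0∞ :=
  if h : ∃ v : Fin d → ℝ, A *ᵥ v = y then ENNReal.ofReal (y ⬝ᵥ h.choose) else ∞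

theorem invNormSq_eq {d : ℕ} {A : Matrix (Fin d) (Fin d) ℝ} (hA : Aᵀ = A) {y v : Fin d → ℝ}
    (hv : A *ᵥ v = y) : invNormSq A y = ENNReal.ofReal (y ⬝ᵥ v) := by
  have h : ∃ v : Fin d → ℝ, A *ᵥ v = y := ⟨v, hv⟩
  have hw : A *ᵥ h.choose = y := h.choose_spec
  have key : y ⬝ᵥ h.choose = y ⬝ᵥ v := by
    calc y ⬝ᵥ h.choose = (A *ᵥ v) ⬝ᵥ h.choose := by rw [hv]
      _ = v ⬝ᵥ (A *ᵥ h.choose) := by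
          rw [Matrix.dotProduct_mulVec, ← Matrix.mulVec_transpose, hA]
      _ = y ⬝ᵥ v := by rw [hw, dotProduct_comm]
  unfold invNormSq
  rw [dif_pos h, key]

theorem invNormSq_eq_top {d : ℕ} {A : Matrix (Fin d) (Fin d) ℝ} {y : Fin d → ℝ}
    (h : ¬ ∃ v : Fin d → ℝ, A *ᵥ v = y) : invNormSq A y = ∞ := by
  unfold invNormSq
  rw [dif_neg h]

theorem invNormSq_eq_generalizedInverse {d : ℕ} {A G : Matrix (Fin d) (Fin d) ℝ} (hA : Aᵀ = A)
    (hG : A * G * A = A) {y : Fin d → ℝ} (h : ∃ v : Fin d → ℝ, A *ᵥ v = y) :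
    invNormSq A y = ENNReal.ofReal (y ⬝ᵥ (G *ᵥ y)) := by
  obtain ⟨v, rfl⟩ := h
  refine invNormSq_eq hA ?_
  rw [Matrix.mulVec_mulVec, Matrix.mulVec_mulVec, hG]

theorem invNormSq_eq_inv {d : ℕ} {A : Matrix (Fin d) (Fin d) ℝ} (hA : Aᵀ = A)
    (hdet : IsUnit A.det) (y : Fin d → ℝ) :
    invNormSq A y = ENNReal.ofReal (y ⬝ᵥ (A⁻¹ *ᵥ y)) := by
  refine invNormSq_eq hA ?_
  rw [Matrix.mulVec_mulVec, Matrix.mul_nonsing_inv A hdet, Matrix.one_mulVec]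

/-- The design matrix is symmetric, so that the lemmas above apply to it. -/
theorem designMatrix_transpose {D d : ℕ} (hd : d ≤ D) (X : Finset (Vec D)) (l : X → ℝ) :
    (designMatrix hd X l)ᵀ = designMatrix hd X l := by
  simp [designMatrix, Matrix.transpose_sum, Matrix.transpose_vecMulVec]

/-- The complexity `ρ*_d` of `(X, Z, θ)` with optimal arm `zs`: the infimum over the designs `l` in
the simplex over `X` of the supremum over `z ∈ Z \ {zs}` of
`‖ψ_d(zs) - ψ_d(z)‖²_{A_d(l)⁻¹} / (h(zs) - h(z))²`, where `h(x) = ⟨θ, x⟩`. -/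
noncomputable def complexity {D d : ℕ} (hd : d ≤ D) (X Z : Finset (Vec D)) (θ zs : Vec D) : ℝ≥0∞ :=
  ⨅ l ∈ stdSimplex ℝ X, ⨆ z ∈ {z : Vec D | z ∈ Z ∧ z ≠ zs},
    invNormSq (designMatrix hd X l) (truncate hd zs - truncate hd z) /
      ENNReal.ofReal ((inner ℝ θ zs - inner ℝ θ z) ^ 2)

end Complexity

section Algorithms

/-- The filtration of the observations on the space of the trajectories `(x_i, y_i)_{i ∈ ℕ}`: the
`σ`-algebra with index `t` is generated by the first `t` pairs `(x_i, y_i)`, `i < t`. -/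
def history {D : ℕ} (X : Finset (Vec D)) :
    Filtration ℕ (inferInstance : MeasurableSpace (ℕ → X × ℝ)) where
  seq t := MeasurableSpace.comap (fun (ω : ℕ → X × ℝ) (i : Fin t) => ω i) inferInstance
  mono' s t hst := by
    rintro _ ⟨B, hB, rfl⟩
    refine ⟨(fun (f : Fin t → X × ℝ) (i : Fin s) => f (Fin.castLE hst i)) ⁻¹' B, ?_, rfl⟩
    exact (measurable_pi_lambda _ fun i => measurable_pi_apply (Fin.castLE hst i)) hB
  le' t := (measurable_pi_lambda _ fun i : Fin t =>
    measurable_pi_apply (X := fun _ : ℕ => X × ℝ) (i : ℕ)).comap_le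

/-- A pure exploration algorithm with action set `X` and target set `Z`. In round `t` (rounds are
numbered from `0`) it plays the action `arm t`, a measurable function of the observations
`(x_i, y_i)`, `i < t`. It stops after `τ` observations, where `τ` is a (possibly infinite)
stopping time, and then recommends the target `recommend`, which is determined by the
observations up to time `τ`. -/
structure Algorithm {D : ℕ} (X Z : Finset (Vec D)) where
  arm : (t : ℕ) → (Fin t → X × ℝ) → X
  measurable_arm : ∀ t, Measurable (arm t)
  τ : (ℕ → X × ℝ) → WithTop ℕ
  isStoppingTime : IsStoppingTime (history X) τ
  recommend : (ℕ → X × ℝ) → Z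
  measurable_recommend : Measurable[isStoppingTime.measurableSpace] recommend

namespace Algorithm

variable {D : ℕ} {X Z : Finset (Vec D)}

/-- The pair (action, reward) of round `t`, after the observations `f` and with noise `u`: the
action `x` is chosen by the algorithm and the reward is `⟨θ, x⟩ + u`. -/
noncomputable def play (alg : Algorithm X Z) (θ : Vec D) (t : ℕ) (f : Fin t → X × ℝ) (u : ℝ) :
    X × ℝ :=
  (alg.arm t f, inner ℝ θ (alg.arm t f : Vec D) + u)

/-- The observations of the first `t` rounds under the parameter `θ` and the noise `ξ`. -/
noncomputable def observations (alg : Algorithm X Z) (θ : Vec D) (ξ : ℕ → ℝ) :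
    (t : ℕ) → (Fin t → X × ℝ)
  | 0 => Fin.elim0
  | t + 1 => Fin.snoc (alg.observations θ ξ t) (alg.play θ t (alg.observations θ ξ t) (ξ t))

/-- The whole trajectory of actions and rewards under the parameter `θ` and the noise `ξ`. -/
noncomputable def trajectory (alg : Algorithm X Z) (θ : Vec D) (ξ : ℕ → ℝ) : ℕ → X × ℝ :=
  fun t => alg.play θ t (alg.observations θ ξ t) (ξ t)

theorem trajectory_eq_observations (alg : Algorithm X Z) (θ : Vec D) (ξ : ℕ → ℝ) (t : ℕ) :
    (fun i : Fin t => alg.trajectory θ ξ i) = alg.observations θ ξ t := by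
  induction t with
  | zero => exact Subsingleton.elim _ _
  | succ t ih =>
    funext i
    refine Fin.lastCases ?_ (fun j => ?_) i
    · simp [observations, trajectory]
    · simpa [observations] using congrFun ih j

theorem measurable_play (alg : Algorithm X Z) (θ : Vec D) (t : ℕ) :
    Measurable fun p : (Fin t → X × ℝ) × ℝ => alg.play θ t p.1 p.2 := by
  have h : Measurable fun p : (Fin t → X × ℝ) × ℝ => alg.arm t p.1 :=
    (alg.measurable_arm t).comp measurable_fst
  have h' : Measurable fun x : X => inner ℝ θ (x : Vec D) :=
    (continuous_const.inner continuous_subtype_val).measurable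
  exact h.prodMk ((h'.comp h).add measurable_snd)

theorem measurable_observations (alg : Algorithm X Z) (θ : Vec D) (t : ℕ) :
    Measurable fun ξ : ℕ → ℝ => alg.observations θ ξ t := by
  induction t with
  | zero => exact measurable_const
  | succ t ih =>
    refine measurable_pi_lambda _ fun i => ?_
    refine Fin.lastCases ?_ (fun j => ?_) i
    · simpa [observations, Function.comp_def] using
        (alg.measurable_play θ t).comp (ih.prodMk (measurable_pi_apply t))
    · simpa [observations, Function.comp_def] using (measurable_pi_apply j).comp ih

theorem measurable_trajectory (alg : Algorithm X Z) (θ : Vec D) :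
    Measurable (alg.trajectory θ) :=
  measurable_pi_lambda _ fun t => (alg.measurable_play θ t).comp
    ((alg.measurable_observations θ t).prodMk (measurable_pi_apply t))

/-- `P_θ`: the law of the trajectory under the parameter `θ`, the noise being i.i.d. `N(0, 1)`. -/
noncomputable def law (alg : Algorithm X Z) (θ : Vec D) : Measure (ℕ → X × ℝ) :=
  (Measure.infinitePi fun _ : ℕ => gaussianReal 0 1).map (alg.trajectory θ)

instance (alg : Algorithm X Z) (θ : Vec D) : IsProbabilityMeasure (alg.law θ) :=
  Measure.isProbabilityMeasure_map (alg.measurable_trajectory θ).aemeasurable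

/-- The expected stopping time `E_θ[τ]`, which is `∞` if `τ = ∞` with positive probability. -/
noncomputable def expectedStoppingTime (alg : Algorithm X Z) (θ : Vec D) : ℝ≥0∞ :=
  ∫⁻ ω, ENat.toENNReal (alg.τ ω) ∂(alg.law θ)

end Algorithm

/-- The set of the optimal arms of `Z` for the parameter `θ`. -/
def optimalArms {D : ℕ} (Z : Finset (Vec D)) (θ : Vec D) : Set (Vec D) :=
  {z | z ∈ Z ∧ ∀ z' ∈ Z, inner ℝ θ z' ≤ inner ℝ θ z}

/-- The optimal arm for `θ` is unique. Targets that have the same reward for every parameter of the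
class `Θ` (for `Θ_d`: targets with the same truncation `ψ_d`) are not told apart here. -/
def UniqueOptimum {D : ℕ} (Z : Finset (Vec D)) (Θ : Set (Vec D)) (θ : Vec D) : Prop :=
  ∀ z ∈ optimalArms Z θ, ∀ z' ∈ optimalArms Z θ, ∀ η ∈ Θ, (inner ℝ η z : ℝ) = inner ℝ η z'

/-- `alg` is `δ`-PAC for `(X, Z, Θ)`: for every parameter of `Θ` with a unique optimal arm, it stops
and recommends the optimal arm with probability at least `1 - δ`. -/
def IsPAC {D : ℕ} {X Z : Finset (Vec D)} (alg : Algorithm X Z) (δ : ℝ) (Θ : Set (Vec D)) : Prop :=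
  ∀ θ ∈ Θ, UniqueOptimum Z Θ θ →
    1 - δ ≤ (alg.law θ).real
      {ω | alg.τ ω ≠ ⊤ ∧ (alg.recommend ω : Vec D) ∈ optimalArms Z θ}

end Algorithms

end LinearBandit

/-!
Suppose that moving the parameter from `θ` to `θ' ∈ Θ_d` makes some `z ≠ zs` better than `zs`. The
algorithm recommends `zs` with probability at least `1 - δ` under `θ`, and at most `δ` under `θ'` if
the optimum of `θ'` is unique. Parameters with a unique optimum are dense in `Θ_d`, so continuity
removes that last proviso. Integrating the tangent inequality `log a + 1 - a * exp (-L) ≤ L` for the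
log-likelihood ratio `L` at the truncated stopping time `min τ n` (with `a = (1 - δ) / δ` on the
event of recommending `zs` by time `n`, and `a = δ / (1 - δ)` off it), and letting `n → ∞`, turns
this gap into a lower bound for the Kullback-Leibler divergence of the stopped observations, which
is half of `∑ₓ E[N_x(τ)] ⟪θ - θ', x⟫²`.

By homogeneity in `η = θ - θ'`, these bounds say that
`c ⟪η, zs - z⟫² ≤ ⟪θ, zs - z⟫² ∑ₓ E[N_x(τ)] ⟪η, x⟫²` for all `η ∈ Θ_d`, where
`c = 2 * (1 - 2 * δ) * log ((1 - δ) / δ)`. Writing the numbers of plays as `E[τ] l` for a design `l`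
and using the duality `‖y‖²_{A⁻¹} ≤ K ↔ ∀ v, (v ⬝ y)² ≤ K (v ⬝ A v)`, this bounds the objective of
the complexity at `l` by `E[τ] / c`; and `c ≥ log (1 / (2.4 * δ))`.
-/

namespace LinearBandit

section ChangeOfMeasure

variable {Ω : Type*} {mΩ : MeasurableSpace Ω} {μ ν : Measure Ω}

theorem mul_log_add_one_sub_le_setIntegral [IsFiniteMeasure μ] [IsFiniteMeasure ν] {S : Set Ω}
    (hS : MeasurableSet S) {L : Ω → ℝ} (hL : IntegrableOn L S μ)
    (hν : ν S = ∫⁻ ω in S, ENNReal.ofReal (Real.exp (-L ω)) ∂μ) {a : ℝ} (ha : 0 < a) :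
    μ.real S * (Real.log a + 1) - a * ν.real S ≤ ∫ ω in S, L ω ∂μ := by
  have hmeas : AEStronglyMeasurable (fun ω => Real.exp (-L ω)) (μ.restrict S) :=
    Real.continuous_exp.comp_aestronglyMeasurable hL.aestronglyMeasurable.neg
  have hexp : IntegrableOn (fun ω => Real.exp (-L ω)) S μ := by
    refine (lintegral_ofReal_ne_top_iff_integrable hmeas (ae_of_all _ fun ω => by positivity)).1 ?_
    exact hν ▸ measure_ne_top ν S
  have hreal : ν.real S = ∫ ω in S, Real.exp (-L ω) ∂μ := by
    rw [measureReal_def, hν, integral_eq_lintegral_of_nonneg_ae (ae_of_all _ fun ω => by positivity)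
      hmeas]
  have htangent (ω : Ω) : Real.log a + 1 - a * Real.exp (-L ω) ≤ L ω := by
    have h := Real.log_le_sub_one_of_pos (mul_pos ha (Real.exp_pos (-L ω)))
    rw [Real.log_mul ha.ne' (Real.exp_ne_zero _), Real.log_exp] at h
    linarith
  calc μ.real S * (Real.log a + 1) - a * ν.real S
      = ∫ ω in S, (Real.log a + 1 - a * Real.exp (-L ω)) ∂μ := by
        rw [integral_sub (integrable_const _) (hexp.const_mul a), setIntegral_const,
          integral_const_mul, ← hreal, smul_eq_mul]
    _ ≤ ∫ ω in S, L ω ∂μ :=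
        setIntegral_mono_on ((integrable_const _).sub (hexp.const_mul a)) hL hS
          fun ω _ => htangent ω

theorem two_mul_measureReal_sub_one_mul_log_le_integral [IsProbabilityMeasure μ]
    [IsProbabilityMeasure ν] {S : Set Ω} (hS : MeasurableSet S) {L : Ω → ℝ} (hL : Integrable L μ)
    (hν : ν S = ∫⁻ ω in S, ENNReal.ofReal (Real.exp (-L ω)) ∂μ)
    (hν' : ν Sᶜ = ∫⁻ ω in Sᶜ, ENNReal.ofReal (Real.exp (-L ω)) ∂μ)
    {δ : ℝ} (hδ0 : 0 < δ) (hδ : δ ≤ 1 / 2) (hνS : ν.real S ≤ δ) :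
    (2 * μ.real S - 1) * Real.log ((1 - δ) / δ) ≤ ∫ ω, L ω ∂μ := by
  set a : ℝ := (1 - δ) / δ with ha
  have ha1 : 1 ≤ a := (one_le_div hδ0).2 (by linarith)
  have ha0 : 0 < a := by linarith
  have hmass : a * ν.real S + a⁻¹ * (1 - ν.real S) ≤ 1 := calc
    a * ν.real S + a⁻¹ * (1 - ν.real S) = a⁻¹ + (a - a⁻¹) * ν.real S := by ring
    _ ≤ a⁻¹ + (a - a⁻¹) * δ := by
      have : a⁻¹ ≤ a := (inv_le_one_of_one_le₀ ha1).trans ha1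
      gcongr
    _ = 1 := by
      have : 1 - δ ≠ 0 := by linarith
      rw [ha]
      field_simp
      ring
  have hbound := mul_log_add_one_sub_le_setIntegral hS hL.integrableOn hν ha0
  have hbound' := mul_log_add_one_sub_le_setIntegral hS.compl hL.integrableOn hν' (inv_pos.2 ha0)
  rw [probReal_compl_eq_one_sub hS, probReal_compl_eq_one_sub hS, Real.log_inv] at hbound'
  rw [← integral_add_compl hS hL]
  linarith

theorem measure_eq_setLIntegral_stoppedValue {ℱ : Filtration ℕ mΩ} {Y : ℕ → Ω → ℝ≥0∞}
    (hY : ∀ (t : ℕ) (S : Set Ω), MeasurableSet[ℱ t] S → ν S = ∫⁻ ω in S, Y t ω ∂μ)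
    {σ : Ω → WithTop ℕ} (hσ : IsStoppingTime ℱ σ) (hfin : ∀ ω, σ ω ≠ ⊤) {S : Set Ω}
    (hS : MeasurableSet[hσ.measurableSpace] S) :
    ν S = ∫⁻ ω in S, stoppedValue Y σ ω ∂μ := by
  have hcover : S = ⋃ t : ℕ, S ∩ {ω | σ ω = WithTop.some t} := by
    ext ω
    obtain ⟨t, ht⟩ := WithTop.ne_top_iff_exists.1 (hfin ω)
    simp only [Set.mem_iUnion, Set.mem_inter_iff, Set.mem_ofPred_eq, ← ht]
    exact ⟨fun h => ⟨t, h, rfl⟩, fun ⟨_, h, _⟩ => h⟩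
  have hmeas (t : ℕ) : MeasurableSet[ℱ t] (S ∩ {ω | σ ω = WithTop.some t}) :=
    (hσ.measurableSet_inter_eq_iff S t).1 (hS.inter (hσ.measurableSet_eq_of_countable' t))
  have hdisj : Pairwise (Function.onFun Disjoint fun t : ℕ => S ∩ {ω | σ ω = WithTop.some t}) :=
    fun s t hst => Set.disjoint_left.2 fun ω hs ht =>
      hst (WithTop.coe_injective (hs.2.symm.trans ht.2))
  rw [hcover, measure_iUnion hdisj fun t => ℱ.le t _ (hmeas t),
    lintegral_iUnion (fun t => ℱ.le t _ (hmeas t)) hdisj]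
  refine tsum_congr fun t => (hY t _ (hmeas t)).trans ?_
  refine setLIntegral_congr_fun (ℱ.le t _ (hmeas t)) fun ω hω => ?_
  simp only [stoppedValue, show σ ω = WithTop.some t from hω.2, WithTop.untopA, WithTop.untopD_coe]

theorem stoppedValue_sum_range_min {β : Type*} [AddCommMonoid β] (f : ℕ → Ω → β)
    (τ : Ω → WithTop ℕ) (n : ℕ) :
    stoppedValue (fun t ω => ∑ i ∈ Finset.range t, f i ω) (fun ω => min (τ ω) (WithTop.some n)) =
      fun ω => ∑ i ∈ Finset.range n, {ω | WithTop.some i < τ ω}.indicator (f i) ω := by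
  ext ω
  simp only [stoppedValue, Set.indicator_apply, Set.mem_ofPred_eq, ← Finset.sum_filter]
  refine Finset.sum_congr ?_ fun _ _ => rfl
  ext i
  generalize τ ω = k
  induction k using WithTop.recTopCoe with
  | top => simp only [le_top, inf_of_le_right, WithTop.untopA, WithTop.untopD_coe, Finset.mem_range,
      Finset.mem_filter, WithTop.coe_lt_top, and_true]
  | coe k => simp only [← WithTop.coe_min, WithTop.untopA, WithTop.untopD_coe, Finset.mem_range,
      Finset.mem_filter, WithTop.coe_lt_coe, lt_min_iff, and_comm]

end ChangeOfMeasure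

theorem toENNReal_eq_tsum (n : WithTop ℕ) :
    ENat.toENNReal n = ∑' t : ℕ, if WithTop.some t < n then 1 else 0 := by
  induction n using WithTop.recTopCoe with
  | top =>
    simp only [WithTop.coe_lt_top, if_true]
    rw [ENNReal.tsum_const_eq_top_of_ne_zero one_ne_zero]
    rfl
  | coe n =>
    simp only [WithTop.coe_lt_coe]
    rw [tsum_eq_sum (s := Finset.range n) fun t ht => if_neg (mt Finset.mem_range.2 ht),
      Finset.sum_congr rfl fun t ht => if_pos (Finset.mem_range.1 ht)]
    simp only [Finset.sum_const, Finset.card_range, nsmul_one]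
    rfl

theorem lintegral_gaussianReal_eq_add_const (m : ℝ) {v : NNReal} (hv : v ≠ 0) (c : ℝ)
    {g : ℝ → ℝ≥0∞} (hg : Measurable g) :
    ∫⁻ u, g u ∂gaussianReal m v =
      ∫⁻ u, g (u + c) * ENNReal.ofReal (Real.exp (-(c * (u - m) + c ^ 2 / 2) / v))
        ∂gaussianReal m v := by
  have hv' : (v : ℝ) ≠ 0 := NNReal.coe_ne_zero.2 hv
  have hpdf (u : ℝ) : gaussianPDF m v (u + c) =
      gaussianPDF m v u * ENNReal.ofReal (Real.exp (-(c * (u - m) + c ^ 2 / 2) / v)) := by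
    rw [gaussianPDF, gaussianPDF, ← ENNReal.ofReal_mul (gaussianPDFReal_nonneg m v u),
      gaussianPDFReal, gaussianPDFReal, mul_assoc _ (Real.exp _), ← Real.exp_add]
    congr 3
    field_simp
    ring
  rw [gaussianReal_of_var_ne_zero _ hv,
    lintegral_withDensity_eq_lintegral_mul _ (measurable_gaussianPDF m v) hg,
    lintegral_withDensity_eq_lintegral_mul _ (measurable_gaussianPDF m v) (by fun_prop),
    ← lintegral_add_right_eq_self _ c]
  refine lintegral_congr fun u => ?_
  simp only [Pi.mul_apply, hpdf]
  ring

theorem measurable_snoc {β : Type*} [MeasurableSpace β] (t : ℕ) :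
    Measurable fun p : (Fin t → β) × β => (Fin.snoc p.1 p.2 : Fin (t + 1) → β) := by
  refine measurable_pi_lambda _ fun i => Fin.lastCases ?_ (fun j => ?_) i
  · simpa using measurable_snd
  · simpa [Function.comp_def] using (measurable_pi_apply j).comp measurable_fst

theorem setIntegral_comp_eq_sum {Ω β : Type*} {mΩ : MeasurableSpace Ω} {μ : Measure Ω}
    [IsFiniteMeasure μ] [Fintype β] [MeasurableSpace β] [MeasurableSingletonClass β] {f : Ω → β}
    (hf : Measurable f) (g : β → ℝ) (S : Set Ω) :
    ∫ ω in S, g (f ω) ∂μ = ∑ b, μ.real (S ∩ {ω | f ω = b}) * g b := by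
  rw [← integral_map hf.aemeasurable (measurable_of_finite g).aestronglyMeasurable,
    integral_fintype (Integrable.of_finite)]
  refine Finset.sum_congr rfl fun b _ => ?_
  have hb : MeasurableSet (f ⁻¹' {b}) := hf (measurableSet_singleton b)
  rw [map_measureReal_apply hf (measurableSet_singleton b), measureReal_restrict_apply hb,
    smul_eq_mul, Set.inter_comm]
  rfl

/-- The law of the noise sequence `ξ`, i.i.d. `N(0, 1)`. -/
noncomputable abbrev noise : Measure (ℕ → ℝ) := Measure.infinitePi fun _ => gaussianReal 0 1

theorem integrable_noise (t : ℕ) : Integrable (fun ξ : ℕ → ℝ => ξ t) noise :=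
  (measurePreserving_eval_infinitePi (fun _ => gaussianReal 0 1) t).integrable_comp_of_integrable
    ((memLp_id_gaussianReal 1).integrable (by simp))

theorem integral_noise (t : ℕ) : ∫ ξ : ℕ → ℝ, ξ t ∂noise = 0 := by
  have h := measurePreserving_eval_infinitePi (fun _ : ℕ => gaussianReal 0 1) t
  rw [← integral_map (f := fun u : ℝ => u) h.measurable.aemeasurable (by fun_prop), h.map_eq,
    integral_id_gaussianReal]

namespace Algorithm

variable {D : ℕ} {X Z : Finset (Vec D)}

theorem observations_congr (alg : Algorithm X Z) (θ : Vec D) {ξ ξ' : ℕ → ℝ} {t : ℕ}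
    (h : ∀ i < t, ξ i = ξ' i) : alg.observations θ ξ t = alg.observations θ ξ' t := by
  induction t with
  | zero => rfl
  | succ t ih =>
    simp only [observations]
    rw [ih fun i hi => h i (hi.trans t.lt_succ_self), h t t.lt_succ_self]

theorem indepFun_observations_noise (alg : Algorithm X Z) (θ : Vec D) (t : ℕ) :
    IndepFun (fun ξ => alg.observations θ ξ t) (fun ξ => ξ t) noise := by
  have hcoord : iIndepFun (fun i (ξ : ℕ → ℝ) => ξ i) noise :=
    iIndepFun_infinitePi (X := fun _ u => u) fun _ => measurable_id
  have hpast := hcoord.indepFun_finset (Finset.range t) {t} (by simp) fun i => measurable_pi_apply i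
  let extend (g : Finset.range t → ℝ) (i : ℕ) : ℝ := if h : i ∈ Finset.range t then g ⟨i, h⟩ else 0
  have hextend : Measurable extend := by
    refine measurable_pi_lambda _ fun i => ?_
    by_cases hi : i ∈ Finset.range t <;> simp only [extend, hi, dite_true, dite_false] <;> fun_prop
  refine (hpast.comp ((alg.measurable_observations θ t).comp hextend)
    (measurable_pi_apply ⟨t, Finset.mem_singleton_self t⟩)).congr (ae_of_all _ fun ξ => ?_)
    (ae_of_all _ fun ξ => rfl)
  exact alg.observations_congr θ fun i hi => by simp [extend, hi]

theorem lintegral_observations_succ (alg : Algorithm X Z) (θ : Vec D) (t : ℕ)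
    {f : (Fin (t + 1) → X × ℝ) → ℝ≥0∞} (hf : Measurable f) :
    ∫⁻ ξ, f (alg.observations θ ξ (t + 1)) ∂noise =
      ∫⁻ ξ, ∫⁻ u, f (Fin.snoc (alg.observations θ ξ t) (alg.play θ t (alg.observations θ ξ t) u))
        ∂gaussianReal 0 1 ∂noise := by
  have hobs := alg.measurable_observations θ t
  have heval : Measurable fun ξ : ℕ → ℝ => ξ t := measurable_pi_apply t
  have hjoint := (indepFun_iff_map_prod_eq_prod_map_map hobs.aemeasurable heval.aemeasurable).1
    (alg.indepFun_observations_noise θ t)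
  have hstep : Measurable fun p : (Fin t → X × ℝ) × ℝ => f (Fin.snoc p.1 (alg.play θ t p.1 p.2)) :=
    hf.comp ((measurable_snoc t).comp (measurable_fst.prodMk (alg.measurable_play θ t)))
  simp only [observations]
  rw [← lintegral_map (μ := noise) (g := fun ξ => (alg.observations θ ξ t, ξ t)) hstep
    (hobs.prodMk heval), hjoint, lintegral_prod _ hstep.aemeasurable, Measure.infinitePi_map_eval,
    lintegral_map hstep.lintegral_prod_right' hobs]

/-- The log-likelihood ratio of `θ` against `θ'` of a single observation `p = (x, y)`, that is
`log (φ(y - ⟪θ, x⟫) / φ(y - ⟪θ', x⟫))` with `φ` the standard Gaussian density, written in terms of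
the noise `y - ⟪θ, x⟫`. -/
noncomputable def logRatio (θ θ' : Vec D) (p : X × ℝ) : ℝ :=
  inner ℝ (θ - θ') (p.1 : Vec D) * (p.2 - inner ℝ θ (p.1 : Vec D)) +
    inner ℝ (θ - θ') (p.1 : Vec D) ^ 2 / 2

/-- The density of a single observation under `θ'` with respect to that under `θ`. -/
noncomputable def density (θ θ' : Vec D) (p : X × ℝ) : ℝ≥0∞ :=
  ENNReal.ofReal (Real.exp (-logRatio θ θ' p))

theorem measurable_inner_fst (η : Vec D) : Measurable fun p : X × ℝ => inner ℝ η (p.1 : Vec D) :=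
  (measurable_of_finite fun x : X => inner ℝ η (x : Vec D)).comp measurable_fst

theorem measurable_logRatio (θ θ' : Vec D) : Measurable (logRatio (X := X) θ θ') :=
  ((measurable_inner_fst _).mul (measurable_snd.sub (measurable_inner_fst _))).add
    (((measurable_inner_fst _).pow_const 2).div_const 2)

theorem measurable_density (θ θ' : Vec D) : Measurable (density (X := X) θ θ') :=
  (Real.measurable_exp.comp (measurable_logRatio θ θ').neg).ennreal_ofReal

/-- The log-likelihood ratio of `θ` against `θ'` of the observations of the first `t` rounds. -/
noncomputable def cumLogRatio (θ θ' : Vec D) (t : ℕ) (ω : ℕ → X × ℝ) : ℝ :=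
  ∑ i ∈ Finset.range t, logRatio θ θ' (ω i)

theorem prod_range_density (θ θ' : Vec D) (t : ℕ) (ω : ℕ → X × ℝ) :
    ∏ i ∈ Finset.range t, density θ θ' (ω i) =
      ENNReal.ofReal (Real.exp (-cumLogRatio θ θ' t ω)) := by
  rw [cumLogRatio, ← Finset.sum_neg_distrib, Real.exp_sum,
    ENNReal.ofReal_prod_of_nonneg fun _ _ => (Real.exp_pos _).le]
  rfl

theorem lintegral_play_eq_mul_density (alg : Algorithm X Z) (θ θ' : Vec D) (t : ℕ)
    (h : Fin t → X × ℝ) {g : X × ℝ → ℝ≥0∞} (hg : Measurable g) :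
    ∫⁻ u, g (alg.play θ' t h u) ∂gaussianReal 0 1 =
      ∫⁻ u, g (alg.play θ t h u) * density θ θ' (alg.play θ t h u) ∂gaussianReal 0 1 := by
  have hplay : Measurable fun u => g (alg.play θ' t h u) :=
    hg.comp ((alg.measurable_play θ' t).comp measurable_prodMk_left)
  rw [lintegral_gaussianReal_eq_add_const 0 one_ne_zero (inner ℝ (θ - θ') (alg.arm t h : Vec D))
    hplay]
  refine lintegral_congr fun u => ?_
  have hshift : alg.play θ' t h (u + inner ℝ (θ - θ') (alg.arm t h : Vec D)) =
      alg.play θ t h u := by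
    simp only [play, inner_sub_left]
    congr 1
    ring
  rw [hshift]
  simp [density, logRatio, play]

theorem lintegral_observations_eq_mul_prod_density (alg : Algorithm X Z) (θ θ' : Vec D) (t : ℕ)
    {f : (Fin t → X × ℝ) → ℝ≥0∞} (hf : Measurable f) :
    ∫⁻ ξ, f (alg.observations θ' ξ t) ∂noise =
      ∫⁻ ξ, f (alg.observations θ ξ t) * ∏ i, density θ θ' (alg.observations θ ξ t i) ∂noise := by
  induction t with
  | zero => simp [observations]
  | succ t ih =>
    have hsnoc (h : Fin t → X × ℝ) : Measurable fun p => f (Fin.snoc h p) :=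
      hf.comp ((measurable_snoc t).comp measurable_prodMk_left)
    have hnext : Measurable fun h : Fin t → X × ℝ =>
        ∫⁻ u, f (Fin.snoc h (alg.play θ' t h u)) ∂gaussianReal 0 1 :=
      (hf.comp ((measurable_snoc t).comp
        (measurable_fst.prodMk (alg.measurable_play θ' t)))).lintegral_prod_right'
    have hprod : Measurable fun h : Fin (t + 1) → X × ℝ => ∏ i, density θ θ' (h i) :=
      Finset.measurable_prod _ fun i _ => (measurable_density θ θ').comp (measurable_pi_apply i)
    rw [alg.lintegral_observations_succ θ' t hf, ih hnext,
      alg.lintegral_observations_succ θ t (f := fun h => f h * ∏ i, density θ θ' (h i))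
        (hf.mul hprod)]
    refine lintegral_congr fun ξ => ?_
    set h := alg.observations θ ξ t
    simp only [Fin.prod_univ_castSucc, Fin.snoc_castSucc, Fin.snoc_last]
    rw [alg.lintegral_play_eq_mul_density θ θ' t h (hsnoc h), ← lintegral_mul_const' _ _
      (ENNReal.prod_ne_top fun i _ => show density θ θ' (h i) ≠ ∞ from ENNReal.ofReal_ne_top)]
    refine lintegral_congr fun u => ?_
    ring

theorem trajectory_preimage (alg : Algorithm X Z) (θ : Vec D) {t : ℕ} (B : Set (Fin t → X × ℝ)) :
    alg.trajectory θ ⁻¹' ((fun (ω : ℕ → X × ℝ) (i : Fin t) => ω i) ⁻¹' B) =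
      (fun ξ => alg.observations θ ξ t) ⁻¹' B := by
  ext ξ
  simp only [Set.mem_preimage, trajectory_eq_observations]

theorem law_eq_setLIntegral (alg : Algorithm X Z) (θ θ' : Vec D) (t : ℕ) {S : Set (ℕ → X × ℝ)}
    (hS : MeasurableSet[history X t] S) :
    alg.law θ' S = ∫⁻ ω in S,
      ENNReal.ofReal (Real.exp (-cumLogRatio θ θ' t ω)) ∂alg.law θ := by
  classical
  have hSm : MeasurableSet S := (history X).le t S hS
  obtain ⟨B, hB, rfl⟩ := hS
  have hdensity : Measurable fun ω : ℕ → X × ℝ => ∏ i ∈ Finset.range t, density θ θ' (ω i) :=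
    Finset.measurable_prod _ fun i _ => (measurable_density θ θ').comp (measurable_pi_apply i)
  have hobs (η : Vec D) := alg.measurable_observations η t hB
  simp only [← prod_range_density]
  rw [law, law, Measure.map_apply (alg.measurable_trajectory θ') hSm,
    setLIntegral_map hSm hdensity (alg.measurable_trajectory θ), trajectory_preimage,
    trajectory_preimage, ← lintegral_indicator_one (hobs θ'), ← lintegral_indicator (hobs θ)]
  refine (alg.lintegral_observations_eq_mul_prod_density θ θ' t
    (f := B.indicator 1) (measurable_one.indicator hB)).trans (lintegral_congr fun ξ => ?_)
  simp only [← trajectory_eq_observations, Finset.prod_range, Set.indicator_apply,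
    Set.mem_preimage, Pi.one_apply, ite_mul, one_mul, zero_mul]

theorem trajectory_snd_sub_inner (alg : Algorithm X Z) (θ : Vec D) (ξ : ℕ → ℝ) (t : ℕ) :
    (alg.trajectory θ ξ t).2 - inner ℝ θ ((alg.trajectory θ ξ t).1 : Vec D) = ξ t := by
  simp [trajectory, play]

theorem measurable_action (t : ℕ) : Measurable fun ω : ℕ → X × ℝ => (ω t).1 :=
  measurable_fst.comp (measurable_pi_apply t)

theorem measurable_comp_action_mul_noise (θ : Vec D) (t : ℕ) (g : X → ℝ) :
    Measurable fun ω : ℕ → X × ℝ => g (ω t).1 * ((ω t).2 - inner ℝ θ ((ω t).1 : Vec D)) :=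
  ((measurable_of_finite g).comp (measurable_action t)).mul
    ((measurable_snd.sub (measurable_inner_fst θ)).comp (measurable_pi_apply t))

theorem integrable_comp_action (alg : Algorithm X Z) (θ : Vec D) (t : ℕ) (g : X → ℝ) :
    Integrable (fun ω => g (ω t).1) (alg.law θ) :=
  (Integrable.of_finite (μ := (alg.law θ).map fun ω => (ω t).1) (f := g)).comp_measurable
    (f := fun ω : ℕ → X × ℝ => (ω t).1) (measurable_action t)

theorem integrable_comp_action_mul_noise (alg : Algorithm X Z) (θ : Vec D) (t : ℕ) (g : X → ℝ) :
    Integrable (fun ω => g (ω t).1 * ((ω t).2 - inner ℝ θ ((ω t).1 : Vec D))) (alg.law θ) := by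
  have hmeas := measurable_comp_action_mul_noise θ t g
  rw [law, integrable_map_measure hmeas.aestronglyMeasurable
    (alg.measurable_trajectory θ).aemeasurable]
  simp only [Function.comp_def, trajectory_snd_sub_inner]
  obtain ⟨C, hC⟩ := (Set.finite_range g).isBounded.exists_norm_le
  have hg : Measurable fun ξ => g (alg.trajectory θ ξ t).1 :=
    (measurable_of_finite g).comp ((measurable_action t).comp (alg.measurable_trajectory θ))
  exact (integrable_noise t).bdd_mul hg.aestronglyMeasurable (ae_of_all _ fun ξ => hC _ ⟨_, rfl⟩)

theorem setIntegral_comp_action_mul_noise (alg : Algorithm X Z) (θ : Vec D) {t : ℕ} (g : X → ℝ)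
    {S : Set (ℕ → X × ℝ)} (hS : MeasurableSet[history X t] S) :
    ∫ ω in S, g (ω t).1 * ((ω t).2 - inner ℝ θ ((ω t).1 : Vec D)) ∂alg.law θ = 0 := by
  classical
  have hmeas := measurable_comp_action_mul_noise θ t g
  have hSm : MeasurableSet S := (history X).le t S hS
  obtain ⟨B, hB, rfl⟩ := hS
  have hG : Measurable (B.indicator fun h => g (alg.arm t h)) :=
    ((measurable_of_finite g).comp (alg.measurable_arm t)).indicator hB
  have hindep := (alg.indepFun_observations_noise θ t).comp hG measurable_id
  rw [law, setIntegral_map hSm hmeas.aestronglyMeasurable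
    (alg.measurable_trajectory θ).aemeasurable, trajectory_preimage,
    ← integral_indicator (alg.measurable_observations θ t hB)]
  calc ∫ ξ, ((fun ξ => alg.observations θ ξ t) ⁻¹' B).indicator (fun ξ =>
        g (alg.trajectory θ ξ t).1 * ((alg.trajectory θ ξ t).2 -
          inner ℝ θ ((alg.trajectory θ ξ t).1 : Vec D))) ξ ∂noise
      = ∫ ξ, B.indicator (fun h => g (alg.arm t h)) (alg.observations θ ξ t) * ξ t ∂noise := by
        refine integral_congr_ae (ae_of_all _ fun ξ => ?_)
        simp only [Set.indicator_apply, Set.mem_preimage, trajectory_snd_sub_inner, ite_mul,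
          zero_mul]
        rfl
    _ = (∫ ξ, B.indicator (fun h => g (alg.arm t h)) (alg.observations θ ξ t) ∂noise) *
        ∫ ξ, ξ t ∂noise :=
        hindep.integral_fun_mul_eq_mul_integral
          (hG.comp (alg.measurable_observations θ t)).aestronglyMeasurable
          (measurable_pi_apply t).aestronglyMeasurable
    _ = 0 := by rw [integral_noise, mul_zero]

theorem integrable_logRatio (alg : Algorithm X Z) (θ θ' : Vec D) (t : ℕ) :
    Integrable (fun ω => logRatio θ θ' (ω t)) (alg.law θ) :=
  (alg.integrable_comp_action_mul_noise θ t fun x => inner ℝ (θ - θ') (x : Vec D)).add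
    (alg.integrable_comp_action θ t fun x => inner ℝ (θ - θ') (x : Vec D) ^ 2 / 2)

theorem setIntegral_logRatio (alg : Algorithm X Z) (θ θ' : Vec D) {t : ℕ} {S : Set (ℕ → X × ℝ)}
    (hS : MeasurableSet[history X t] S) :
    ∫ ω in S, logRatio θ θ' (ω t) ∂alg.law θ =
      ∑ x : X, (alg.law θ).real (S ∩ {ω | (ω t).1 = x}) *
        (inner ℝ (θ - θ') (x : Vec D) ^ 2 / 2) := by
  simp only [logRatio]
  rw [integral_add
      (alg.integrable_comp_action_mul_noise θ t fun x => inner ℝ (θ - θ') (x : Vec D)).integrableOn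
      (alg.integrable_comp_action θ t fun x => inner ℝ (θ - θ') (x : Vec D) ^ 2 / 2).integrableOn,
    alg.setIntegral_comp_action_mul_noise θ (fun x => inner ℝ (θ - θ') (x : Vec D)) hS, zero_add]
  exact setIntegral_comp_eq_sum (μ := alg.law θ) (measurable_action t)
    (fun x => inner ℝ (θ - θ') (x : Vec D) ^ 2 / 2) S

theorem measurableSet_lt_τ (alg : Algorithm X Z) (t : ℕ) :
    MeasurableSet[history X t] {ω | WithTop.some t < alg.τ ω} :=
  alg.isStoppingTime.measurableSet_gt t

theorem expectedStoppingTime_eq_tsum (alg : Algorithm X Z) (θ : Vec D) :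
    alg.expectedStoppingTime θ = ∑' t : ℕ, alg.law θ {ω | WithTop.some t < alg.τ ω} := by
  have hmeas (t : ℕ) := (history X).le t _ (alg.measurableSet_lt_τ t)
  simp only [expectedStoppingTime, toENNReal_eq_tsum]
  rw [lintegral_tsum fun t =>
    (Measurable.ite (hmeas t) measurable_const measurable_const).aemeasurable]
  refine tsum_congr fun t => ?_
  rw [← lintegral_indicator_one (hmeas t)]
  exact lintegral_congr fun ω => by simp only [Set.indicator_apply, Set.mem_ofPred_eq, Pi.one_apply]

/-- The expected number `E_θ[N_x(τ)]` of plays of the action `x` up to the stopping time. -/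
noncomputable def expectedPlays (alg : Algorithm X Z) (θ : Vec D) (x : X) : ℝ≥0∞ :=
  ∑' t : ℕ, alg.law θ ({ω | WithTop.some t < alg.τ ω} ∩ {ω | (ω t).1 = x})

theorem sum_expectedPlays (alg : Algorithm X Z) (θ : Vec D) :
    ∑ x : X, alg.expectedPlays θ x = alg.expectedStoppingTime θ := by
  have hmeas (t : ℕ) (x : X) :
      MeasurableSet ({ω | WithTop.some t < alg.τ ω} ∩ {ω : ℕ → X × ℝ | (ω t).1 = x}) :=
    ((history X).le t _ (alg.measurableSet_lt_τ t)).inter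
      (measurable_action t (measurableSet_singleton x))
  simp only [expectedPlays]
  rw [← Summable.tsum_finsetSum fun x _ => ENNReal.summable, expectedStoppingTime_eq_tsum]
  refine tsum_congr fun t => ?_
  rw [← measure_biUnion_finset
    (fun x _ y _ hxy => Set.disjoint_left.2 fun ω hx hy => hxy (hx.2.symm.trans hy.2))
    fun x _ => hmeas t x]
  congr 1
  ext ω
  simp

theorem expectedPlays_ne_top (alg : Algorithm X Z) {θ : Vec D}
    (hτ : alg.expectedStoppingTime θ ≠ ∞) (x : X) : alg.expectedPlays θ x ≠ ∞ := by
  rw [← sum_expectedPlays] at hτ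
  exact ENNReal.sum_ne_top.1 hτ x (Finset.mem_univ x)

theorem stoppedValue_cumLogRatio_min (alg : Algorithm X Z) (θ θ' : Vec D) (n : ℕ) :
    stoppedValue (cumLogRatio θ θ') (fun ω => min (alg.τ ω) (WithTop.some n)) = fun ω =>
      ∑ i ∈ Finset.range n,
        {ω | WithTop.some i < alg.τ ω}.indicator (fun ω => logRatio θ θ' (ω i)) ω := by
  rw [← stoppedValue_sum_range_min]
  rfl

theorem integrable_indicator_logRatio (alg : Algorithm X Z) (θ θ' : Vec D) (t : ℕ) :
    Integrable ({ω | WithTop.some t < alg.τ ω}.indicator fun ω => logRatio θ θ' (ω t))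
      (alg.law θ) :=
  (alg.integrable_logRatio θ θ' t).indicator ((history X).le t _ (alg.measurableSet_lt_τ t))

theorem integrable_stoppedValue_cumLogRatio (alg : Algorithm X Z) (θ θ' : Vec D) (n : ℕ) :
    Integrable (stoppedValue (cumLogRatio θ θ') fun ω => min (alg.τ ω) (WithTop.some n))
      (alg.law θ) := by
  rw [stoppedValue_cumLogRatio_min]
  exact integrable_finsetSum _ fun t _ => alg.integrable_indicator_logRatio θ θ' t

/-- The quadratic form `η ↦ ∑ₓ E_θ[N_x(τ)] ⟪η, x⟫²` of the expected numbers of plays; half of its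
value at `θ - θ'` is the Kullback-Leibler divergence between the laws of the stopped observations
under `θ` and `θ'`. It is meant for finite `E_θ[τ]`: infinite numbers of plays count as `0`. -/
noncomputable def information (alg : Algorithm X Z) (θ η : Vec D) : ℝ :=
  ∑ x : X, (alg.expectedPlays θ x).toReal * inner ℝ η (x : Vec D) ^ 2

theorem sum_range_measureReal_le_expectedPlays (alg : Algorithm X Z) {θ : Vec D}
    (hτ : alg.expectedStoppingTime θ ≠ ∞) (x : X) (n : ℕ) :
    ∑ t ∈ Finset.range n, (alg.law θ).real ({ω | WithTop.some t < alg.τ ω} ∩ {ω | (ω t).1 = x}) ≤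
      (alg.expectedPlays θ x).toReal := by
  simp only [measureReal_def]
  rw [← ENNReal.toReal_sum fun t _ => measure_ne_top _ _]
  exact ENNReal.toReal_mono (alg.expectedPlays_ne_top hτ x) (ENNReal.sum_le_tsum _)

theorem integral_stoppedValue_cumLogRatio_le (alg : Algorithm X Z) {θ : Vec D} (θ' : Vec D)
    (hτ : alg.expectedStoppingTime θ ≠ ∞) (n : ℕ) :
    ∫ ω, stoppedValue (cumLogRatio θ θ') (fun ω => min (alg.τ ω) (WithTop.some n)) ω ∂alg.law θ ≤
      alg.information θ (θ - θ') / 2 := by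
  rw [stoppedValue_cumLogRatio_min,
    integral_finsetSum _ fun t _ => alg.integrable_indicator_logRatio θ θ' t]
  calc ∑ t ∈ Finset.range n, ∫ ω, {ω | WithTop.some t < alg.τ ω}.indicator
        (fun ω => logRatio θ θ' (ω t)) ω ∂alg.law θ
      = ∑ t ∈ Finset.range n, ∑ x : X,
          (alg.law θ).real ({ω | WithTop.some t < alg.τ ω} ∩ {ω | (ω t).1 = x}) *
            (inner ℝ (θ - θ') (x : Vec D) ^ 2 / 2) := by
        refine Finset.sum_congr rfl fun t _ => ?_
        rw [integral_indicator ((history X).le t _ (alg.measurableSet_lt_τ t)),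
          alg.setIntegral_logRatio θ θ' (alg.measurableSet_lt_τ t)]
    _ = ∑ x : X, (∑ t ∈ Finset.range n,
          (alg.law θ).real ({ω | WithTop.some t < alg.τ ω} ∩ {ω | (ω t).1 = x})) *
            (inner ℝ (θ - θ') (x : Vec D) ^ 2 / 2) := by
        simp only [Finset.sum_mul]
        exact Finset.sum_comm
    _ ≤ ∑ x : X, (alg.expectedPlays θ x).toReal * (inner ℝ (θ - θ') (x : Vec D) ^ 2 / 2) := by
        gcongr with x
        exact alg.sum_range_measureReal_le_expectedPlays hτ x n
    _ = alg.information θ (θ - θ') / 2 := by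
        simp only [information, Finset.sum_div, mul_div_assoc]

theorem tendsto_measureReal_inter_τ_le (alg : Algorithm X Z) (θ : Vec D) (S : Set (ℕ → X × ℝ)) :
    Filter.Tendsto (fun n : ℕ => (alg.law θ).real (S ∩ {ω | alg.τ ω ≤ WithTop.some n}))
      Filter.atTop (nhds ((alg.law θ).real (S ∩ {ω | alg.τ ω ≠ ⊤}))) := by
  have hmono : Monotone fun n : ℕ => S ∩ {ω | alg.τ ω ≤ WithTop.some n} := fun m n hmn =>
    Set.inter_subset_inter_right S fun ω hω => le_trans hω (WithTop.coe_le_coe.2 hmn)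
  have hunion : ⋃ n : ℕ, S ∩ {ω | alg.τ ω ≤ WithTop.some n} = S ∩ {ω | alg.τ ω ≠ ⊤} := by
    rw [← Set.inter_iUnion]
    congr 1
    ext ω
    simp only [Set.mem_iUnion, Set.mem_ofPred_eq, ne_eq]
    refine ⟨fun ⟨n, hn⟩ => ne_top_of_le_ne_top WithTop.coe_ne_top hn, fun hω => ?_⟩
    obtain ⟨n, hn⟩ := WithTop.ne_top_iff_exists.1 hω
    exact ⟨n, hn.ge⟩
  rw [← hunion]
  exact (ENNReal.tendsto_toReal (measure_ne_top _ _)).comp (tendsto_measure_iUnion_atTop hmono)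

theorem two_mul_measureReal_inter_le_sub_one_mul_log_le_information (alg : Algorithm X Z)
    {θ θ' : Vec D} (hτ : alg.expectedStoppingTime θ ≠ ∞) {S : Set (ℕ → X × ℝ)}
    (hS : MeasurableSet[alg.isStoppingTime.measurableSpace] S) {δ : ℝ} (hδ0 : 0 < δ)
    (hδ : δ ≤ 1 / 2) (n : ℕ)
    (hθ' : (alg.law θ').real (S ∩ {ω | alg.τ ω ≤ WithTop.some n}) ≤ δ) :
    (2 * (alg.law θ).real (S ∩ {ω | alg.τ ω ≤ WithTop.some n}) - 1) * Real.log ((1 - δ) / δ) ≤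
      alg.information θ (θ - θ') / 2 := by
  have hσ : IsStoppingTime (history X) fun ω => min (alg.τ ω) (WithTop.some n) :=
    alg.isStoppingTime.min_const n
  have hfin (ω : ℕ → X × ℝ) : min (alg.τ ω) (WithTop.some n) ≠ ⊤ :=
    ne_top_of_le_ne_top WithTop.coe_ne_top (min_le_right _ _)
  have hSn : MeasurableSet[hσ.measurableSpace] (S ∩ {ω | alg.τ ω ≤ WithTop.some n}) :=
    (alg.isStoppingTime.measurableSet_inter_le_const_iff S n).1
      (hS.inter (alg.isStoppingTime.measurableSet_le' n))
  have hdensity {B : Set (ℕ → X × ℝ)} (hB : MeasurableSet[hσ.measurableSpace] B) :=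
    measure_eq_setLIntegral_stoppedValue (fun t _ => alg.law_eq_setLIntegral θ θ' t) hσ hfin hB
  exact (two_mul_measureReal_sub_one_mul_log_le_integral (hσ.measurableSpace_le _ hSn)
    (alg.integrable_stoppedValue_cumLogRatio θ θ' n) (hdensity hSn) (hdensity hSn.compl) hδ0 hδ
    hθ').trans (alg.integral_stoppedValue_cumLogRatio_le θ' hτ n)

theorem two_mul_measureReal_sub_one_mul_log_le_information (alg : Algorithm X Z)
    {θ θ' : Vec D} (hτ : alg.expectedStoppingTime θ ≠ ∞) {S : Set (ℕ → X × ℝ)}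
    (hS : MeasurableSet[alg.isStoppingTime.measurableSpace] S) {δ : ℝ} (hδ0 : 0 < δ)
    (hδ : δ ≤ 1 / 2) (hθ' : (alg.law θ').real (S ∩ {ω | alg.τ ω ≠ ⊤}) ≤ δ) :
    (2 * (alg.law θ).real (S ∩ {ω | alg.τ ω ≠ ⊤}) - 1) * Real.log ((1 - δ) / δ) ≤
      alg.information θ (θ - θ') / 2 := by
  have hlim := (((alg.tendsto_measureReal_inter_τ_le θ S).const_mul 2).sub_const 1).mul_const
    (Real.log ((1 - δ) / δ))
  refine le_of_tendsto hlim (Filter.Eventually.of_forall fun n => ?_)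
  refine alg.two_mul_measureReal_inter_le_sub_one_mul_log_le_information hτ hS hδ0 hδ n ?_
  refine (measureReal_mono ?_).trans hθ'
  exact Set.inter_subset_inter_right S fun ω hω => ne_top_of_le_ne_top WithTop.coe_ne_top hω

end Algorithm

section UniqueOptimum

variable {D : ℕ}

theorem exists_mem_forall_inner_eq_imp (Z : Finset (Vec D)) (V : Submodule ℝ (Vec D)) :
    ∃ η ∈ V, ∀ z ∈ Z, ∀ z' ∈ Z, (inner ℝ η z : ℝ) = inner ℝ η z' →
      ∀ η' ∈ V, (inner ℝ η' z : ℝ) = inner ℝ η' z' := by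
  let ι := {p : Z × Z // ∃ η ∈ V, (inner ℝ (p.1 - p.2 : Vec D) η : ℝ) ≠ 0}
  obtain ⟨η, hη, hne⟩ := Module.Dual.exists_forall_mem_ne_zero_of_forall_exists V
    (fun p : ι => (innerSL ℝ (p.1.1 - p.1.2 : Vec D)).toLinearMap) fun p => p.2
  refine ⟨η, hη, fun z hz z' hz' heq η' hη' => ?_⟩
  by_contra hne'
  refine hne ⟨(⟨z, hz⟩, ⟨z', hz'⟩), η', hη', ?_⟩ ?_
  · rw [real_inner_comm, inner_sub_right]
    exact sub_ne_zero.2 hne'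
  · change inner ℝ (z - z') η = 0
    rw [real_inner_comm, inner_sub_right, heq, sub_self]

theorem dense_setOf_forall_add_mul_ne_zero {ι : Type*} (s : Set ι) (hs : s.Finite) (a b : ι → ℝ)
    (hb : ∀ i ∈ s, b i ≠ 0) : Dense {r : ℝ | ∀ i ∈ s, a i + r * b i ≠ 0} := by
  refine ((hs.image fun i => -a i / b i).countable.dense_compl ℝ).mono fun r hr i hi hzero => ?_
  refine hr ⟨i, hi, ?_⟩
  rw [div_eq_iff (hb i hi)]
  linarith

theorem subset_closure_setOf_uniqueOptimum (Z : Finset (Vec D)) (V : Submodule ℝ (Vec D)) :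
    (V : Set (Vec D)) ⊆ closure {θ | θ ∈ V ∧ UniqueOptimum Z V θ} := by
  intro θ hθ
  obtain ⟨η, hη, hsep⟩ := exists_mem_forall_inner_eq_imp Z V
  let s : Set (Vec D × Vec D) := {p | p ∈ Z ×ˢ Z ∧ (inner ℝ η (p.1 - p.2) : ℝ) ≠ 0}
  have hdense := dense_setOf_forall_add_mul_ne_zero s
    ((Z ×ˢ Z).finite_toSet.subset fun p => And.left) (fun p => inner ℝ θ (p.1 - p.2))
    (fun p => inner ℝ η (p.1 - p.2)) fun p => And.right
  have hcont : Continuous fun r : ℝ => θ + r • η := by fun_prop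
  have hclosure := map_mem_closure hcont (hdense 0) (t := {θ | θ ∈ V ∧ UniqueOptimum Z V θ}) ?_
  · simpa using hclosure
  refine fun r hr => ⟨V.add_mem hθ (V.smul_mem r hη), fun z hz z' hz' => ?_⟩
  refine hsep z hz.1 z' hz'.1 (by_contra fun hne => ?_)
  refine hr (z, z') ⟨Finset.mk_mem_product hz.1 hz'.1, ?_⟩ ?_
  · rw [inner_sub_right]
    exact sub_ne_zero.2 hne
  · have hopt := (hz'.2 z hz.1).antisymm (hz.2 z' hz'.1)
    simp only [inner_add_left, real_inner_smul_left] at hopt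
    simp only [inner_sub_right]
    linarith

theorem optimalArms_subset_singleton {Z : Finset (Vec D)} {θ zs : Vec D} (hzs : zs ∈ Z)
    (hopt : ∀ z ∈ Z, z ≠ zs → (inner ℝ θ z : ℝ) < inner ℝ θ zs) : optimalArms Z θ ⊆ {zs} :=
  fun z hz => by_contra fun hne => (hopt z hz.1 hne).not_ge (hz.2 zs hzs)

theorem uniqueOptimum_of_optimalArms_subset_singleton {Z : Finset (Vec D)} {θ zs : Vec D}
    (h : optimalArms Z θ ⊆ {zs}) (Θ : Set (Vec D)) : UniqueOptimum Z Θ θ :=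
  fun z hz z' hz' η _ => by rw [h hz, h hz']

end UniqueOptimum

namespace Algorithm

variable {D : ℕ} {X Z : Finset (Vec D)}

theorem measurableSet_recommend_eq (alg : Algorithm X Z) (z : Vec D) :
    MeasurableSet[alg.isStoppingTime.measurableSpace] {ω | (alg.recommend ω : Vec D) = z} :=
  alg.measurable_recommend (Set.toFinite {z' : Z | (z' : Vec D) = z}).measurableSet

theorem one_sub_le_measureReal_recommend_eq {alg : Algorithm X Z} {δ : ℝ} {Θ : Set (Vec D)}
    (hPAC : IsPAC alg δ Θ) {θ zs : Vec D} (hθ : θ ∈ Θ) (hzs : zs ∈ Z)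
    (hopt : ∀ z ∈ Z, z ≠ zs → (inner ℝ θ z : ℝ) < inner ℝ θ zs) :
    1 - δ ≤ (alg.law θ).real ({ω | (alg.recommend ω : Vec D) = zs} ∩ {ω | alg.τ ω ≠ ⊤}) := by
  have hsub := optimalArms_subset_singleton hzs hopt
  exact (hPAC θ hθ (uniqueOptimum_of_optimalArms_subset_singleton hsub Θ)).trans
    (measureReal_mono fun ω hω => ⟨hsub hω.2, hω.1⟩)

theorem measureReal_recommend_eq_le {alg : Algorithm X Z} {δ : ℝ} {Θ : Set (Vec D)}
    (hPAC : IsPAC alg δ Θ) {θ z z' : Vec D} (hθ : θ ∈ Θ) (huniq : UniqueOptimum Z Θ θ)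
    (hz' : z' ∈ Z) (hlt : (inner ℝ θ z : ℝ) < inner ℝ θ z') :
    (alg.law θ).real ({ω | (alg.recommend ω : Vec D) = z} ∩ {ω | alg.τ ω ≠ ⊤}) ≤ δ := by
  have hmeas : MeasurableSet {ω | (alg.recommend ω : Vec D) = z} :=
    alg.isStoppingTime.measurableSpace_le _ (alg.measurableSet_recommend_eq z)
  have hsub : {ω | alg.τ ω ≠ ⊤ ∧ (alg.recommend ω : Vec D) ∈ optimalArms Z θ} ⊆
      ({ω | (alg.recommend ω : Vec D) = z})ᶜ := by
    rintro ω ⟨-, hω⟩ rfl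
    exact hlt.not_ge (hω.2 z' hz')
  have hcompl := (hPAC θ hθ huniq).trans (measureReal_mono hsub)
  rw [probReal_compl_eq_one_sub hmeas] at hcompl
  exact (measureReal_mono Set.inter_subset_left).trans (by linarith)

theorem continuous_information (alg : Algorithm X Z) (θ : Vec D) :
    Continuous (alg.information θ) := by
  unfold information
  fun_prop

theorem information_smul (alg : Algorithm X Z) (θ η : Vec D) (r : ℝ) :
    alg.information θ (r • η) = r ^ 2 * alg.information θ η := by
  simp only [information, real_inner_smul_left, Finset.mul_sum]
  exact Finset.sum_congr rfl fun x _ => by ring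

theorem information_nonneg (alg : Algorithm X Z) (θ η : Vec D) : 0 ≤ alg.information θ η :=
  Finset.sum_nonneg fun _ _ => mul_nonneg ENNReal.toReal_nonneg (sq_nonneg _)

section LowerBound

variable {alg : Algorithm X Z} {V : Submodule ℝ (Vec D)} {δ : ℝ} {θ zs : Vec D}

theorem le_information_sub_of_uniqueOptimum (hPAC : IsPAC alg δ V) (hδ0 : 0 < δ)
    (hδ : δ ≤ 1 / 2) (hθ : θ ∈ V) (hzs : zs ∈ Z)
    (hopt : ∀ z ∈ Z, z ≠ zs → (inner ℝ θ z : ℝ) < inner ℝ θ zs)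
    (hτ : alg.expectedStoppingTime θ ≠ ∞) {θ' z : Vec D} (hθ' : θ' ∈ V)
    (huniq : UniqueOptimum Z V θ') (hz : z ∈ Z) (hlt : (inner ℝ θ' zs : ℝ) < inner ℝ θ' z) :
    2 * (1 - 2 * δ) * Real.log ((1 - δ) / δ) ≤ alg.information θ (θ - θ') := by
  have hlog : 0 ≤ Real.log ((1 - δ) / δ) := Real.log_nonneg ((one_le_div hδ0).2 (by linarith))
  have hprob := one_sub_le_measureReal_recommend_eq hPAC hθ hzs hopt
  have htransport := alg.two_mul_measureReal_sub_one_mul_log_le_information hτ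
    (alg.measurableSet_recommend_eq zs) hδ0 hδ (measureReal_recommend_eq_le hPAC hθ' huniq hz hlt)
  have := mul_le_mul_of_nonneg_right hprob hlog
  linarith

theorem le_information_sub (hPAC : IsPAC alg δ V) (hδ0 : 0 < δ)
    (hδ : δ ≤ 1 / 2) (hθ : θ ∈ V) (hzs : zs ∈ Z)
    (hopt : ∀ z ∈ Z, z ≠ zs → (inner ℝ θ z : ℝ) < inner ℝ θ zs)
    (hτ : alg.expectedStoppingTime θ ≠ ∞) {θ' z : Vec D} (hθ' : θ' ∈ V)
    (hz : z ∈ Z) (hlt : (inner ℝ θ' zs : ℝ) < inner ℝ θ' z) :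
    2 * (1 - 2 * δ) * Real.log ((1 - δ) / δ) ≤ alg.information θ (θ - θ') := by
  have hopen : IsOpen {θ' : Vec D | (inner ℝ θ' zs : ℝ) < inner ℝ θ' z} :=
    isOpen_lt (by fun_prop) (by fun_prop)
  have hclosed : IsClosed {θ' : Vec D | 2 * (1 - 2 * δ) * Real.log ((1 - δ) / δ) ≤
      alg.information θ (θ - θ')} :=
    isClosed_le continuous_const ((alg.continuous_information θ).comp (by fun_prop))
  refine closure_minimal ?_ hclosed
    (hopen.inter_closure ⟨hlt, subset_closure_setOf_uniqueOptimum Z V hθ'⟩)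
  rintro θ'' ⟨hlt'', hθ'', huniq⟩
  exact le_information_sub_of_uniqueOptimum hPAC hδ0 hδ hθ hzs hopt hτ hθ'' huniq hz hlt''

theorem le_information_of_inner_sub_eq (hPAC : IsPAC alg δ V) (hδ0 : 0 < δ)
    (hδ : δ ≤ 1 / 2) (hθ : θ ∈ V) (hzs : zs ∈ Z)
    (hopt : ∀ z ∈ Z, z ≠ zs → (inner ℝ θ z : ℝ) < inner ℝ θ zs)
    (hτ : alg.expectedStoppingTime θ ≠ ∞) {η z : Vec D} (hη : η ∈ V) (hz : z ∈ Z) (hne : z ≠ zs)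
    (hgap : (inner ℝ η (zs - z) : ℝ) = inner ℝ θ (zs - z)) :
    2 * (1 - 2 * δ) * Real.log ((1 - δ) / δ) ≤ alg.information θ η := by
  have hbound (r : ℝ) (hr : 1 < r) :
      2 * (1 - 2 * δ) * Real.log ((1 - δ) / δ) ≤ r ^ 2 * alg.information θ η := by
    rw [← information_smul, ← sub_sub_cancel θ (r • η)]
    refine le_information_sub hPAC hδ0 hδ hθ hzs hopt hτ (V.sub_mem hθ (V.smul_mem r hη)) hz ?_
    have hpos := hopt z hz hne
    simp only [inner_sub_right] at hgap
    simp only [inner_sub_left, real_inner_smul_left]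
    nlinarith
  have hlim : Filter.Tendsto (fun r : ℝ => r ^ 2 * alg.information θ η)
      (nhdsWithin 1 (Set.Ioi 1)) (nhds (1 ^ 2 * alg.information θ η)) :=
    (Continuous.tendsto (by fun_prop) 1).mono_left nhdsWithin_le_nhds
  simp only [one_pow, one_mul] at hlim
  exact ge_of_tendsto hlim (eventually_nhdsWithin_of_forall hbound)

theorem mul_inner_sub_sq_le_information (hPAC : IsPAC alg δ V) (hδ0 : 0 < δ)
    (hδ : δ ≤ 1 / 2) (hθ : θ ∈ V) (hzs : zs ∈ Z)
    (hopt : ∀ z ∈ Z, z ≠ zs → (inner ℝ θ z : ℝ) < inner ℝ θ zs)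
    (hτ : alg.expectedStoppingTime θ ≠ ∞) {η z : Vec D} (hη : η ∈ V) (hz : z ∈ Z) (hne : z ≠ zs) :
    2 * (1 - 2 * δ) * Real.log ((1 - δ) / δ) * inner ℝ η (zs - z) ^ 2 ≤
      inner ℝ θ (zs - z) ^ 2 * alg.information θ η := by
  rcases eq_or_ne (inner ℝ η (zs - z) : ℝ) 0 with hzero | hzero
  · rw [hzero, zero_pow two_ne_zero, mul_zero]
    exact mul_nonneg (sq_nonneg _) (alg.information_nonneg θ η)
  have hbound := le_information_of_inner_sub_eq hPAC hδ0 hδ hθ hzs hopt hτ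
    (V.smul_mem (inner ℝ θ (zs - z) / inner ℝ η (zs - z)) hη) hz hne
    (by rw [real_inner_smul_left, div_mul_cancel₀ _ hzero])
  rwa [information_smul, div_pow, div_mul_eq_mul_div, le_div_iff₀ (by positivity)] at hbound

end LowerBound

end Algorithm

/-- The parameter class `Θ_d` as a linear subspace of `ℝ^D`. -/
def paramSubmodule (D d : ℕ) : Submodule ℝ (Vec D) where
  carrier := paramClass D d
  add_mem' hθ hη i hi := by rw [PiLp.add_apply, hθ i hi, hη i hi, add_zero]
  zero_mem' _ _ := rfl
  smul_mem' r θ hθ i hi := by rw [PiLp.smul_apply, hθ i hi, smul_zero]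

/-- The vector of `Θ_d` whose first `d` coordinates are those of `v`: the section `ℝ^d → Θ_d` of
the truncation `ψ_d`. -/
noncomputable def extendZero {d : ℕ} (D : ℕ) (v : Fin d → ℝ) : Vec D :=
  WithLp.toLp 2 fun i => if h : (i : ℕ) < d then v ⟨i, h⟩ else 0

theorem extendZero_mem {d : ℕ} (D : ℕ) (v : Fin d → ℝ) : extendZero D v ∈ paramClass D d :=
  fun _ hi => dif_neg hi.not_gt

theorem inner_extendZero {D d : ℕ} (hd : d ≤ D) (v : Fin d → ℝ) (x : Vec D) :
    (inner ℝ (extendZero D v) x : ℝ) = v ⬝ᵥ truncate hd x := by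
  obtain ⟨k, rfl⟩ := Nat.exists_eq_add_of_le hd
  rw [PiLp.inner_apply, Fin.sum_univ_add]
  simp [extendZero, dotProduct, truncate, mul_comm, Fin.castLE, Fin.castAdd]

theorem dotProduct_designMatrix_mulVec {D d : ℕ} (hd : d ≤ D) (X : Finset (Vec D)) (l : X → ℝ)
    (v : Fin d → ℝ) :
    v ⬝ᵥ (designMatrix hd X l *ᵥ v) = ∑ x : X, l x * (v ⬝ᵥ truncate hd (x : Vec D)) ^ 2 := by
  simp only [designMatrix, Matrix.sum_mulVec, dotProduct_sum, Matrix.smul_mulVec,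
    Matrix.vecMulVec_mulVec, dotProduct_smul, smul_eq_mul, op_smul_eq_mul]
  refine Finset.sum_congr rfl fun x _ => ?_
  rw [dotProduct_comm (truncate hd (x : Vec D)) v, sq]

theorem exists_dotProduct_ne_zero_forall_dotProduct_mulVec_eq_zero {K m n : Type*} [Field K]
    [Fintype m] [Fintype n] {A : Matrix m n K} {y : m → K} (h : ¬ ∃ v : n → K, A *ᵥ v = y) :
    ∃ w : m → K, w ⬝ᵥ y ≠ 0 ∧ ∀ v : n → K, w ⬝ᵥ (A *ᵥ v) = 0 := by
  classical
  have hy : y ∉ LinearMap.range A.mulVecLin := fun ⟨v, hv⟩ => h ⟨v, hv⟩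
  obtain ⟨f, hf, hker⟩ := Submodule.exists_le_ker_of_notMem hy
  obtain ⟨w, rfl⟩ := (dotProductEquiv K m).surjective f
  exact ⟨w, hf, fun v => hker ⟨v, rfl⟩⟩

theorem invNormSq_le_ofReal {d : ℕ} {A : Matrix (Fin d) (Fin d) ℝ} {y : Fin d → ℝ} {K : ℝ}
    (h : ∀ v : Fin d → ℝ, (v ⬝ᵥ y) ^ 2 ≤ K * (v ⬝ᵥ (A *ᵥ v))) :
    invNormSq A y ≤ ENNReal.ofReal K := by
  unfold invNormSq
  split_ifs with hrange
  · rcases le_or_gt (y ⬝ᵥ hrange.choose) 0 with hneg | hpos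
    · rw [ENNReal.ofReal_of_nonpos hneg]
      exact zero_le
    refine ENNReal.ofReal_le_ofReal (le_of_mul_le_mul_right ?_ hpos)
    simpa only [hrange.choose_spec, dotProduct_comm _ y, sq] using h hrange.choose
  · obtain ⟨w, hw, hw0⟩ := exists_dotProduct_ne_zero_forall_dotProduct_mulVec_eq_zero hrange
    have hle := h w
    rw [hw0 w, mul_zero] at hle
    exact absurd hle (sq_pos_of_ne_zero hw).not_ge

theorem exists_mem_stdSimplex_sum_smul_eq {𝕜 ι : Type*} [Field 𝕜] [LinearOrder 𝕜]
    [IsStrictOrderedRing 𝕜] [Fintype ι] [Nonempty ι] {N : ι → 𝕜} (hN : ∀ i, 0 ≤ N i) :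
    ∃ l ∈ stdSimplex 𝕜 ι, (∑ i, N i) • l = N := by
  classical
  rcases eq_or_ne (∑ i, N i) 0 with hzero | hne
  · refine ⟨_, single_mem_stdSimplex 𝕜 (Classical.arbitrary ι), ?_⟩
    rw [hzero, zero_smul]
    exact funext fun i => ((Finset.sum_eq_zero_iff_of_nonneg fun i _ => hN i).1 hzero i
      (Finset.mem_univ i)).symm
  · refine ⟨(∑ i, N i)⁻¹ • N, ⟨fun i => ?_, ?_⟩, smul_inv_smul₀ hne N⟩
    · exact mul_nonneg (inv_nonneg.2 (Finset.sum_nonneg fun i _ => hN i)) (hN i)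
    · simp only [Pi.smul_apply, smul_eq_mul, ← Finset.mul_sum, inv_mul_cancel₀ hne]

namespace Algorithm

variable {D d : ℕ} {X Z : Finset (Vec D)}

theorem exists_design_information_extendZero_eq (hd : d ≤ D) (alg : Algorithm X Z) {θ : Vec D}
    (hτ : alg.expectedStoppingTime θ ≠ ∞) :
    ∃ l ∈ stdSimplex ℝ X, ∀ v : Fin d → ℝ, alg.information θ (extendZero D v) =
      (alg.expectedStoppingTime θ).toReal * (v ⬝ᵥ (designMatrix hd X l *ᵥ v)) := by
  have : Nonempty X := ⟨alg.arm 0 Fin.elim0⟩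
  obtain ⟨l, hl, hsmul⟩ := exists_mem_stdSimplex_sum_smul_eq
    fun x : X => ENNReal.toReal_nonneg (a := alg.expectedPlays θ x)
  refine ⟨l, hl, fun v => ?_⟩
  rw [← ENNReal.toReal_sum fun x _ => alg.expectedPlays_ne_top hτ x, sum_expectedPlays] at hsmul
  rw [dotProduct_designMatrix_mulVec, information, Finset.mul_sum]
  refine Finset.sum_congr rfl fun x _ => ?_
  rw [← congrFun hsmul x, Pi.smul_apply, smul_eq_mul, inner_extendZero hd, mul_assoc]

theorem complexity_mul_ofReal_le_expectedStoppingTime (hd : d ≤ D) {alg : Algorithm X Z} {δ : ℝ}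
    (hPAC : IsPAC alg δ (paramClass D d)) (hδ0 : 0 < δ) (hδ : δ ≤ 1 / 2) {θ zs : Vec D}
    (hθ : θ ∈ paramClass D d) (hzs : zs ∈ Z)
    (hopt : ∀ z ∈ Z, z ≠ zs → (inner ℝ θ z : ℝ) < inner ℝ θ zs) :
    complexity hd X Z θ zs * ENNReal.ofReal (2 * (1 - 2 * δ) * Real.log ((1 - δ) / δ)) ≤
      alg.expectedStoppingTime θ := by
  rcases eq_or_ne (alg.expectedStoppingTime θ) ∞ with hτ | hτ
  · exact hτ ▸ le_top
  rcases le_or_gt (2 * (1 - 2 * δ) * Real.log ((1 - δ) / δ)) 0 with hc | hc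
  · rw [ENNReal.ofReal_of_nonpos hc, mul_zero]
    exact zero_le
  have hbound {η z : Vec D} (hη : η ∈ paramClass D d) (hz : z ∈ Z) (hne : z ≠ zs) :=
    mul_inner_sub_sq_le_information (V := paramSubmodule D d) hPAC hδ0 hδ hθ hzs hopt hτ hη hz hne
  set c := 2 * (1 - 2 * δ) * Real.log ((1 - δ) / δ)
  obtain ⟨l, hl, hinfo⟩ := alg.exists_design_information_extendZero_eq hd hτ
  set E := (alg.expectedStoppingTime θ).toReal with hE
  have hnorm (z : Vec D) (hz : z ∈ Z) (hne : z ≠ zs) :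
      invNormSq (designMatrix hd X l) (truncate hd zs - truncate hd z) ≤
        ENNReal.ofReal (E / c * (inner ℝ θ zs - inner ℝ θ z) ^ 2) := by
    refine invNormSq_le_ofReal fun v => ?_
    have hv := hbound (extendZero_mem D v) hz hne
    rw [hinfo, inner_sub_right, inner_sub_right, inner_extendZero hd, inner_extendZero hd,
      ← dotProduct_sub, mul_comm c, ← le_div_iff₀ hc] at hv
    exact hv.trans_eq (by ring)
  rw [← ENNReal.ofReal_toReal hτ, ← hE, ← div_mul_cancel₀ E hc.ne',
    ENNReal.ofReal_mul (div_nonneg ENNReal.toReal_nonneg hc.le)]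
  refine mul_le_mul_left ?_ _
  refine (iInf₂_le l hl).trans (iSup₂_le fun z hz => ?_)
  refine ENNReal.div_le_of_le_mul ((hnorm z hz.1 hz.2).trans_eq ?_)
  exact ENNReal.ofReal_mul (div_nonneg ENNReal.toReal_nonneg hc.le)

end Algorithm

theorem log_one_div_le_mul_log_of_le {δ : ℝ} (hδ0 : 0 < δ) (hδ : δ ≤ 1 / 4) :
    Real.log (1 / (2.4 * δ)) ≤ 2 * (1 - 2 * δ) * Real.log ((1 - δ) / δ) := by
  have hmono : Real.log (1 / (2.4 * δ)) ≤ Real.log ((1 - δ) / δ) := by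
    refine Real.log_le_log (by positivity) ?_
    rw [div_le_div_iff₀ (by positivity) hδ0]
    nlinarith
  have hlog : 0 ≤ Real.log ((1 - δ) / δ) := Real.log_nonneg ((one_le_div hδ0).2 (by linarith))
  exact hmono.trans (le_mul_of_one_le_left hlog (by linarith))

theorem log_one_div_le_mul_log_of_ge {δ : ℝ} (hδ4 : 1 / 4 ≤ δ) (hδ : δ ≤ 1 / 2) :
    Real.log (1 / (2.4 * δ)) ≤ 2 * (1 - 2 * δ) * Real.log ((1 - δ) / δ) := by
  have hpos : 0 < δ := by linarith
  have hpos' : 0 < 1 - δ := by linarith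
  calc Real.log (1 / (2.4 * δ)) ≤ 1 / (2.4 * δ) - 1 := Real.log_le_sub_one_of_pos (by positivity)
    _ ≤ 2 * (1 - 2 * δ) * (1 - ((1 - δ) / δ)⁻¹) := by
      have hfactor : 0 ≤ (4 * δ - 1) * (24 * δ ^ 2 - 21 * δ + 5) :=
        mul_nonneg (by linarith) (by nlinarith [sq_nonneg (δ - 7 / 16)])
      rw [inv_div, div_sub_one (by positivity), one_sub_div hpos'.ne', ← mul_div_assoc,
        div_le_div_iff₀ (by positivity) hpos']
      linarith
    _ ≤ 2 * (1 - 2 * δ) * Real.log ((1 - δ) / δ) :=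
      mul_le_mul_of_nonneg_left (Real.one_sub_inv_le_log_of_pos (by positivity)) (by linarith)

end LinearBandit

theorem mainTheorem3_general {D d : ℕ} (hd : d ≤ D) (X Z : Finset (LinearBandit.Vec D))
    (δ : ℝ) (hδ0 : 0 < δ)
    (θ : LinearBandit.Vec D) (hθ : θ ∈ LinearBandit.paramClass D d)
    (zs : LinearBandit.Vec D) (hzs : zs ∈ Z)
    (hopt : ∀ z ∈ Z, z ≠ zs → (inner ℝ θ z : ℝ) < inner ℝ θ zs)
    (alg : LinearBandit.Algorithm X Z)
    (hPAC : LinearBandit.IsPAC alg δ (LinearBandit.paramClass D d)) :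
    LinearBandit.complexity hd X Z θ zs * ENNReal.ofReal (Real.log (1 / (2.4 * δ))) ≤
      alg.expectedStoppingTime θ := by
  rcases le_or_gt δ (1 / 2) with hδ | hδ
  · have hlog : Real.log (1 / (2.4 * δ)) ≤ 2 * (1 - 2 * δ) * Real.log ((1 - δ) / δ) :=
      (le_total δ (1 / 4)).elim (LinearBandit.log_one_div_le_mul_log_of_le hδ0)
        fun h => LinearBandit.log_one_div_le_mul_log_of_ge h hδ
    exact (mul_le_mul_right (ENNReal.ofReal_le_ofReal hlog) _).trans
      (LinearBandit.Algorithm.complexity_mul_ofReal_le_expectedStoppingTime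
        hd hPAC hδ0 hδ hθ hzs hopt)
  · have hlog : Real.log (1 / (2.4 * δ)) ≤ 0 :=
      Real.log_nonpos (by positivity) ((div_le_one (by positivity)).2 (by linarith))
    rw [ENNReal.ofReal_of_nonpos hlog, mul_zero]
    exact zero_le

theorem mainTheorem3 {D d : ℕ} (hd : d ≤ D) (X Z : Finset (LinearBandit.Vec D))
    (δ : ℝ) (hδ0 : 0 < δ) (hδ : δ ≤ 0.15)
    (θ : LinearBandit.Vec D) (hθ : θ ∈ LinearBandit.paramClass D d)
    (zs : LinearBandit.Vec D) (hzs : zs ∈ Z)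
    (hopt : ∀ z ∈ Z, z ≠ zs → (inner ℝ θ z : ℝ) < inner ℝ θ zs)
    (alg : LinearBandit.Algorithm X Z)
    (hPAC : LinearBandit.IsPAC alg δ (LinearBandit.paramClass D d)) :
    LinearBandit.complexity hd X Z θ zs * ENNReal.ofReal (Real.log (1 / (2.4 * δ))) ≤
      alg.expectedStoppingTime θ :=
  mainTheorem3_general hd X Z δ hδ0 θ hθ zs hzs hopt alg hPAC
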